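/- Let $G$ be a finite simple graph (not necessarily connected) with vertex set $V$, let $K$ be a field, and let $S=K[x_i,y_i : i\in V]$ with the standard grading. The binomial edge ideal of $G$ is the ideal $J_G\subseteq S$ generated by the binomials $x_iy_j-x_jy_i$ for all edges $\{i,j\}$ of $G$. For $T\subseteq V$ let $G_1,\dots,G_c$ be the connected components of $G\setminus T$, let $\tilde G_k$ be the complete graph on $V(G_k)$, and let $P_T(G)$ be the ideal of $S$ generated by the variables $x_i,y_i$ with $i\in T$ and by $J_{\tilde G_1},\dots,J_{\tilde G_c}$. For a proper graded ideal $I\subseteq S$ and an associated prime $\mathfrak p\in\mathrm{Ass}(S/I)$, the local $\mathrm v$-number $\mathrm v_{\mathfrak p}(I)$ is the least $d\ge 0$ such that $(I:f)=\mathfrak p$ for some homogeneous $f\in S$ of degree $d$, and $\mathrm v(I)$ is the least $d\ge 0$ such that $(I:f)\in\mathrm{Ass}(S/I)$ for some homogeneous $f\in S$ of degree $d$. For $v\in V$ let $G_v$ be the graph on $V$ obtained from $G$ by making all neighbours of $v$ pairwise adjacent, and for $W=\{v_1,\dots,v_k\}\subseteq V$ let $G_W=(\cdots((G_{v_1})_{v_2})\cdots)_{v_k}$,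 which does not depend on the order of the $v_i$. A set $W\subseteq V$ is a completion set of $G$ if $G_W$ is a disjoint union of complete graphs, and it is a minimal completion set if moreover no proper subset of $W$ is a completion set. Let $\mathrm{min\mbox{-}comp}(G)$ be the least cardinality of a minimal completion set of $G$. **Theorem.** The ideal $P_\emptyset(G)$ is a minimal prime, and an associated prime, of $J_G$, and $$\mathrm v_{P_\emptyset(G)}(J_G)=\mathrm{min\mbox{-}comp}(G).$$ In particular, $\mathrm v(J_G)\le \mathrm{min\mbox{-}comp}(G)$. -/

import Mathlib

namespace BinomialEdgeIdeal

noncomputable section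

/-! ### v-numbers of ideals in a polynomial ring -/

/-- The degrees `d` of the homogeneous polynomials `f` (standard grading) with `(I : f) = p`. -/
def localVDegrees {σ K : Type*} [Field K] (I p : Ideal (MvPolynomial σ K)) : Set ℕ :=
  {d | ∃ f : MvPolynomial σ K, f.IsHomogeneous d ∧ I.colon {f} = p}

/-- The local v-number of `I` at `p`: the least degree of a homogeneous `f` with `(I : f) = p`.
It takes values in `ℕ∞`, and it is `⊤` exactly when there is no such `f`. -/
def localVNumber {σ K : Type*} [Field K] (I p : Ideal (MvPolynomial σ K)) : ℕ∞ :=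
  ⨅ d ∈ localVDegrees I p, (d : ℕ∞)

/-- The v-number of `I`: the least degree of a homogeneous `f` such that `(I : f)` is an
associated prime of `I`. It is `⊤` exactly when there is no such `f`. -/
def vNumber {σ K : Type*} [Field K] (I : Ideal (MvPolynomial σ K)) : ℕ∞ :=
  ⨅ d ∈ {d : ℕ | ∃ f : MvPolynomial σ K, f.IsHomogeneous d ∧
    ∃ p ∈ associatedPrimes (MvPolynomial σ K) (MvPolynomial σ K ⧸ I), I.colon {f} = p}, (d : ℕ∞)

/-! ### Binomial edge ideals -/

/-- The variable `x_i` of `S = K[x_i, y_i : i ∈ V]`. -/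
def xVar {V : Type*} (K : Type*) [Field K] (i : V) : MvPolynomial (V ⊕ V) K :=
  MvPolynomial.X (Sum.inl i)

/-- The variable `y_i` of `S = K[x_i, y_i : i ∈ V]`. -/
def yVar {V : Type*} (K : Type*) [Field K] (i : V) : MvPolynomial (V ⊕ V) K :=
  MvPolynomial.X (Sum.inr i)

/-- The binomial edge ideal `J_G`, generated by the `x_i y_j - x_j y_i` for the edges `{i, j}`
of `G`. (An edge is listed in both orders; the two generators differ by a sign.) -/
def binomialEdgeIdeal {V : Type*} (K : Type*) [Field K] (G : SimpleGraph V) :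
    Ideal (MvPolynomial (V ⊕ V) K) :=
  Ideal.span {f | ∃ i j : V, G.Adj i j ∧ f = xVar K i * yVar K j - xVar K j * yVar K i}

/-- The disjoint union of the complete graphs on the vertex sets of the connected components
of `G \ T` (the vertices of `T` are isolated). -/
def componentCompletion {V : Type*} (G : SimpleGraph V) (T : Set V) : SimpleGraph V where
  Adj i j := i ≠ j ∧ ∃ (hi : i ∈ Tᶜ) (hj : j ∈ Tᶜ), (G.induce Tᶜ).Reachable ⟨i, hi⟩ ⟨j, hj⟩
  symm := ⟨fun _ _ h => ⟨h.1.symm, h.2.2.1, h.2.1, h.2.2.2.symm⟩⟩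
  loopless := ⟨fun _ h => h.1 rfl⟩

/-- The ideal `P_T(G)`, generated by the `x_i, y_i` for `i ∈ T` and by the binomial edge ideals
of the complete graphs on the connected components of `G \ T`. -/
def cutPrime {V : Type*} (K : Type*) [Field K] (G : SimpleGraph V) (T : Set V) :
    Ideal (MvPolynomial (V ⊕ V) K) :=
  Ideal.span (xVar K '' T ∪ yVar K '' T) ⊔ binomialEdgeIdeal K (componentCompletion G T)

/-! ### Completion sets -/

/-- The graph `G_v`, obtained from `G` by making the neighbours of `v` pairwise adjacent. -/
def completeAt {V : Type*} (G : SimpleGraph V) (v : V) : SimpleGraph V where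
  Adj i j := G.Adj i j ∨ (i ≠ j ∧ G.Adj v i ∧ G.Adj v j)
  symm := ⟨fun _ _ h => h.elim (fun h => Or.inl h.symm) fun h => Or.inr ⟨h.1.symm, h.2.2, h.2.1⟩⟩
  loopless := ⟨fun _ h => h.elim (fun h => h.ne rfl) fun h => h.1 rfl⟩

/-- `(G_u)_v = (G_v)_u`. -/
instance completeAt_rightCommutative {V : Type*} :
    RightCommutative (completeAt : SimpleGraph V → V → SimpleGraph V) where
  right_comm G u v := by
    ext i j
    have h1 := G.adj_comm
    have h2 : ∀ a, ¬ G.Adj a a := fun a => G.loopless.irrefl a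
    simp only [completeAt]
    grind

/-- The graph `G_W = (… (G_{v₁})_{v₂} …)_{v_k}` for `W = {v₁, …, v_k}`. -/
def iteratedCompletion {V : Type*} (G : SimpleGraph V) (W : Finset V) : SimpleGraph V :=
  W.val.foldl completeAt G

/-- `G` is a disjoint union of complete graphs: distinct vertices in the same connected component
are adjacent. -/
def IsDisjointUnionOfComplete {V : Type*} (G : SimpleGraph V) : Prop :=
  ∀ i j : V, G.Reachable i j → i ≠ j → G.Adj i j

def IsCompletionSet {V : Type*} (G : SimpleGraph V) (W : Finset V) : Prop :=
  IsDisjointUnionOfComplete (iteratedCompletion G W)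

/-- A completion set none of whose proper subsets is a completion set. -/
def IsMinimalCompletionSet {V : Type*} (G : SimpleGraph V) (W : Finset V) : Prop :=
  IsCompletionSet G W ∧ ∀ U : Finset V, U ⊂ W → ¬ IsCompletionSet G U

/-- The least cardinality of a minimal completion set; a finite graph has one, as shown below. -/
def minComp {V : Type*} (G : SimpleGraph V) : ℕ :=
  sInf {k | ∃ W : Finset V, IsMinimalCompletionSet G W ∧ W.card = k}

/-- The set of all vertices is a completion set. -/
theorem isCompletionSet_univ {V : Type*} [Fintype V] (G : SimpleGraph V) :
    IsCompletionSet G Finset.univ := by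
  have key : ∀ (s : Multiset V) (H : SimpleGraph V) (v : V),
      (v ∈ s ∨ ∀ i j, H.Adj v i → H.Adj v j → i ≠ j → H.Adj i j) →
      ∀ i j, (s.foldl completeAt H).Adj v i → (s.foldl completeAt H).Adj v j → i ≠ j →
        (s.foldl completeAt H).Adj i j := by
    intro s
    induction s using Multiset.induction_on with
    | empty => intro H v h; simpa using h
    | cons a s ih =>
      intro H v h
      rw [Multiset.foldl_cons]
      apply ih
      have h1 := H.adj_comm
      have h2 : ∀ a, ¬ H.Adj a a := fun a => H.loopless.irrefl a
      rw [Multiset.mem_cons] at h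
      by_cases hs : v ∈ s
      · exact Or.inl hs
      right
      intro i j
      simp only [completeAt]
      rcases h with (rfl | h) | h
      · grind
      · exact absurd h hs
      · grind
  intro i j hij
  obtain ⟨p⟩ := hij
  induction p with
  | nil => intro h; exact absurd rfl h
  | @cons a b c hab _ ih =>
    intro hac
    by_cases hbc : b = c
    · exact hbc ▸ hab
    · exact key _ G b (Or.inl (Finset.mem_univ b)) a c hab.symm (ih hbc) hac

/-- A finite graph has a minimal completion set. -/
theorem exists_isMinimalCompletionSet {V : Type*} [Finite V] (G : SimpleGraph V) :
    ∃ W : Finset V, IsMinimalCompletionSet G W := by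
  have := Fintype.ofFinite V
  obtain ⟨W, hW, hmin⟩ := (wellFounded_lt (α := Finset V)).has_min
    {W | IsCompletionSet G W} ⟨_, isCompletionSet_univ G⟩
  exact ⟨W, hW, fun U hU hc => hmin U hc hU⟩

end

end BinomialEdgeIdeal

/-!
The ideal `P_∅(G)` is the kernel of the monomial map `x_i ↦ a_i`, `y_i ↦ a_i w_c`, where `c` is the
connected component of `i` (`cutPrime_empty_eq_ker`); so it is prime, and `(J_G : f) = P_∅(G)` holds
if and only if `f ∉ P_∅(G)` and `f · P_∅(G) ⊆ J_G` (`colon_eq_cutPrime_empty`,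
`notMem_of_colon_eq`). The question is thus in which degrees there are such multipliers `f`.

For the upper bound, `x_v · J_{G_v} ⊆ J_G` for every vertex `v`, and `J_{G_W} = P_∅(G)` for a
completion set `W`. Hence `∏_{v ∈ W} x_v` is a multiplier (`IsCompletionSet.prod_xVar_mul_mem`),
which also gives minimality and associatedness of `P_∅(G)`.

For the lower bound, let `f` be a multiplier of degree `d`. Its image under the monomial map has a
monomial `a^α w^β` with `|α| = d`, and the support `W` of `α` has at most `d` elements. It is a
completion set (`minComp_le_of_isHomogeneous`): otherwise there are vertices `i` and `j`, connected
in `G` and not adjacent in `G_W`. These are then separated by the complement `T` of `W ∪ {i, j}`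
(`iteratedCompletion_adj_of_reachable`). The monomial map belonging to `P_T(G)` kills `J_G`, but not
the element `x_i y_j - x_j y_i` of `P_∅(G)`, so it kills `f`. By specialization, the image of `f`
under the first monomial map vanishes at `a_T = 0` (`coeff_blockHom_eq_zero`), although its monomial
`a^α w^β` survives there.
-/

namespace BinomialEdgeIdeal

open MvPolynomial

/-! ### Toric parametrizations -/

section Segre

variable {V K R R' : Type*} [Field K] [CommRing R] [Algebra K R] [CommRing R'] [Algebra K R']

/-- The `K`-algebra homomorphism `x_i ↦ a_i`, `y_i ↦ a_i b_i`. -/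
noncomputable def segreHom (a b : V → R) : MvPolynomial (V ⊕ V) K →ₐ[K] R :=
  aeval (Sum.elim a fun i => a i * b i)

@[simp]
theorem segreHom_xVar (a b : V → R) (i : V) : segreHom a b (xVar K i) = a i := by
  simp [segreHom, xVar]

@[simp]
theorem segreHom_yVar (a b : V → R) (i : V) : segreHom a b (yVar K i) = a i * b i := by
  simp [segreHom, yVar]

theorem segreHom_binomial (a b : V → R) (i j : V) :
    segreHom a b (xVar K i * yVar K j - xVar K j * yVar K i) = a i * a j * (b j - b i) := by
  simp only [map_sub, map_mul, segreHom_xVar, segreHom_yVar]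
  ring

theorem binomialEdgeIdeal_le_ker_segreHom {G : SimpleGraph V} {a b : V → R}
    (h : ∀ i j, G.Adj i j → a i = 0 ∨ a j = 0 ∨ b i = b j) :
    binomialEdgeIdeal K G ≤ RingHom.ker (segreHom (K := K) a b) := by
  refine Ideal.span_le.2 ?_
  rintro _ ⟨i, j, hij, rfl⟩
  rw [SetLike.mem_coe, RingHom.mem_ker, segreHom_binomial]
  rcases h i j hij with h | h | h <;> simp [h]

theorem comp_segreHom (ψ : R →ₐ[K] R') (a b : V → R) :
    ψ.comp (segreHom a b) = segreHom (K := K) (fun i => ψ (a i)) (fun i => ψ (b i)) := by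
  refine algHom_ext fun s => ?_
  rcases s with i | i <;> simp [segreHom]

end Segre

section Block

variable {V C K : Type*} [Field K]

/-- The exponents of the monomials to which `blockHom` sends the variables. -/
noncomputable def blockExponent (π : V → C) : V ⊕ V → (V ⊕ C →₀ ℕ) :=
  Sum.elim (fun i => Finsupp.single (Sum.inl i) 1)
    fun i => Finsupp.single (Sum.inl i) 1 + Finsupp.single (Sum.inr (π i)) 1

/-- The monomial map `x_i ↦ a_i`, `y_i ↦ a_i w_{π i}`, where `π` assigns to each vertex its block
in a partition of `V`. The target has the variables `a_i = X (inl i)` and `w_c = X (inr c)`. -/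
noncomputable def blockHom (K : Type*) [Field K] (π : V → C) :
    MvPolynomial (V ⊕ V) K →ₐ[K] MvPolynomial (V ⊕ C) K :=
  segreHom (fun i => X (Sum.inl i)) fun i => X (Sum.inr (π i))

theorem blockHom_monomial (π : V → C) (m : V ⊕ V →₀ ℕ) (c : K) :
    blockHom K π (monomial m c) = monomial (Finsupp.weight (blockExponent π) m) c := by
  have h : (Sum.elim (fun i => X (Sum.inl i)) fun i => X (Sum.inl i) * X (Sum.inr (π i))) =
      fun s => (monomial (blockExponent π s) 1 : MvPolynomial (V ⊕ C) K) := by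
    funext s
    rcases s with i | i <;> simp [blockExponent, X, monomial_mul]
  rw [blockHom, segreHom, h, aeval_monomial, Finsupp.weight_apply]
  simp only [monomial_pow, one_pow, Finsupp.prod, Finsupp.sum]
  rw [← monomial_sum_one, algebraMap_eq, C_mul_monomial, mul_one]

theorem weight_blockExponent_inl (π : V → C) (m : V ⊕ V →₀ ℕ) (i : V) :
    Finsupp.weight (blockExponent π) m (Sum.inl i) = m (Sum.inl i) + m (Sum.inr i) := by
  classical
  induction m using Finsupp.induction_linear with
  | zero => simp
  | add f g hf hg => simp only [map_add, Finsupp.add_apply, hf, hg]; ring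
  | single s n =>
    rcases s with k | k <;> simp [Finsupp.weight_single, blockExponent, Finsupp.single_apply]

theorem weight_blockExponent_inr [Fintype V] (π : V → C) (m : V ⊕ V →₀ ℕ)
    (c : C) [DecidablePred fun i => π i = c] :
    Finsupp.weight (blockExponent π) m (Sum.inr c) = ∑ i with π i = c, m (Sum.inr i) := by
  classical
  induction m using Finsupp.induction_linear with
  | zero => simp
  | add f g hf hg => simp only [map_add, Finsupp.add_apply, hf, hg, Finset.sum_add_distrib]
  | single s n =>
    rcases s with k | k <;>
      simp [Finsupp.weight_single, blockExponent, Finsupp.single_apply, Finset.sum_ite_eq]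

/-- Two monomials with the same image under `blockHom` are congruent modulo the binomials inside
the blocks: exchanging an `x` and a `y` inside a block brings the `y`-exponents of one closer to
those of the other. -/
theorem monomial_sub_monomial_mem [Finite V] {π : V → C} {J : Ideal (MvPolynomial (V ⊕ V) K)}
    (hJ : ∀ i j, π i = π j → xVar K i * yVar K j - xVar K j * yVar K i ∈ J)
    {m m' : V ⊕ V →₀ ℕ}
    (h : Finsupp.weight (blockExponent π) m = Finsupp.weight (blockExponent π) m') :
    monomial m (1 : K) - monomial m' 1 ∈ J := by
  classical
  have := Fintype.ofFinite V
  induction hn : ∑ i, (m (Sum.inr i) - m' (Sum.inr i)) using Nat.strong_induction_on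
    generalizing m with
  | _ n ih =>
  have hl : ∀ i, m (Sum.inl i) + m (Sum.inr i) = m' (Sum.inl i) + m' (Sum.inr i) := fun i => by
    rw [← weight_blockExponent_inl π, h, weight_blockExponent_inl]
  have hr : ∀ c, ∑ i with π i = c, m (Sum.inr i) = ∑ i with π i = c, m' (Sum.inr i) := fun c => by
    rw [← weight_blockExponent_inr, h, weight_blockExponent_inr]
  by_cases hle : ∀ i, m (Sum.inr i) ≤ m' (Sum.inr i)
  · have heq : ∀ i, m (Sum.inr i) = m' (Sum.inr i) := fun i =>
      (Finset.sum_eq_sum_iff_of_le fun i _ => hle i).1 (hr (π i)) i (by simp)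
    have : m = m' := by
      ext s
      rcases s with i | i
      · have := hl i
        have := heq i
        omega
      · exact heq i
    simp [this]
  push Not at hle
  obtain ⟨i, hi⟩ := hle
  obtain ⟨j, hj, hij⟩ : ∃ j, m (Sum.inr j) < m' (Sum.inr j) ∧ π j = π i := by
    by_contra! hcon
    refine (Finset.sum_lt_sum (s := {k | π k = π i}) (f := fun k => m' (Sum.inr k))
      (g := fun k => m (Sum.inr k)) (fun k hk => ?_) ⟨i, by simp, hi⟩).ne (hr (π i)).symm
    by_contra! hk'
    exact hcon k hk' (by simpa using hk)
  have hne : i ≠ j := by rintro rfl; omega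
  -- `m = p · y_i x_j`, and the exchange replaces it by `p · x_i y_j`
  obtain ⟨p, rfl⟩ : ∃ p, m = p + Finsupp.single (Sum.inr i) 1 + Finsupp.single (Sum.inl j) 1 := by
    refine ⟨m - (Finsupp.single (Sum.inr i) 1 + Finsupp.single (Sum.inl j) 1), ?_⟩
    rw [add_assoc, tsub_add_cancel_of_le]
    have hi' : 0 < m (Sum.inr i) := by omega
    have hj' : 0 < m (Sum.inl j) := by have := hl j; omega
    intro s
    rcases s with k | k <;>
      simp only [Finsupp.add_apply, Finsupp.single_apply, reduceCtorEq, if_false, Sum.inr.injEq,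
        Sum.inl.injEq, add_zero, zero_add] <;>
      split_ifs <;> subst_vars <;> omega
  have key := ih (∑ k, ((p + Finsupp.single (Sum.inl i) 1 + Finsupp.single (Sum.inr j) 1 :
      V ⊕ V →₀ ℕ) (Sum.inr k) - m' (Sum.inr k))) ?_ ?_ rfl
  · have hb := J.mul_mem_left (monomial p 1) (hJ j i hij)
    convert J.add_mem hb key using 1
    have e : ∀ s t : V ⊕ V, monomial (p + Finsupp.single s 1 + Finsupp.single t 1) (1 : K) =
        monomial p 1 * (X s * X t) := fun s t => by
      simp [X, monomial_mul, add_assoc]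
    rw [e, e, xVar, xVar, yVar, yVar]
    ring
  · rw [← hn]
    refine Finset.sum_lt_sum (fun k _ => ?_) ⟨i, Finset.mem_univ _, ?_⟩
    · simp only [Finsupp.add_apply, Finsupp.single_apply, reduceCtorEq, if_false, Sum.inr.injEq,
        add_zero] at hj ⊢
      split_ifs <;> subst_vars <;> simp_all <;> omega
    · simp [hne] at hi ⊢
      omega
  · rw [← h]
    simp only [map_add, Finsupp.weight_single, blockExponent, Sum.elim_inl, Sum.elim_inr, one_smul,
      hij]
    abel

theorem ker_blockHom_le [Finite V] {π : V → C} {J : Ideal (MvPolynomial (V ⊕ V) K)}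
    (hJ : ∀ i j, π i = π j → xVar K i * yVar K j - xVar K j * yVar K i ∈ J) :
    RingHom.ker (blockHom K π) ≤ J := by
  classical
  intro f hf
  rw [RingHom.mem_ker] at hf
  -- `s` chooses one monomial in each fibre of the exponent map
  let μ := Finsupp.weight (R := ℕ) (blockExponent π)
  let s := Function.invFun μ
  have hs : ∀ m, μ (s (μ m)) = μ m := fun m => Function.invFun_eq ⟨m, rfl⟩
  -- the linear map `monomial n ↦ monomial (s n)` sends the image of `g` to a polynomial
  -- congruent to `g`
  let L : MvPolynomial (V ⊕ C) K →ₗ[K] MvPolynomial (V ⊕ V) K :=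
    (basisMonomials (V ⊕ C) K).constr K fun n => monomial (s n) (1 : K)
  have hL : ∀ n (c : K), L (monomial n c) = monomial (s n) c := fun n c => by
    have : L (monomial n 1) = monomial (s n) 1 := by
      have := (basisMonomials (V ⊕ C) K).constr_basis K (fun n => monomial (s n) (1 : K)) n
      rwa [coe_basisMonomials] at this
    rw [← mul_one c, ← smul_eq_mul, ← smul_monomial, map_smul, this, smul_monomial]
  have key : ∀ g : MvPolynomial (V ⊕ V) K, g - L (blockHom K π g) ∈ J := by
    intro g
    induction g using MvPolynomial.induction_on' with
    | monomial m c =>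
      rw [blockHom_monomial, hL]
      convert J.mul_mem_left (MvPolynomial.C c) (monomial_sub_monomial_mem hJ (hs m).symm) using 1
      simp [mul_sub, C_mul_monomial, μ]
    | add p q hp hq =>
      rw [map_add, map_add, add_sub_add_comm]
      exact J.add_mem hp hq
  simpa [hf] using key f

end Block

/-! ### The prime `P_∅(G)` -/

section EmptyCut

variable {V K : Type*} [Field K] {G : SimpleGraph V}

theorem componentCompletion_empty_adj {i j : V} :
    (componentCompletion G ∅).Adj i j ↔ i ≠ j ∧ G.Reachable i j := by
  refine and_congr_right fun _ => ⟨?_, fun h => ?_⟩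
  · rintro ⟨hi, hj, h⟩
    exact h.map (SimpleGraph.Embedding.induce _).toHom
  · let φ : G →g G.induce (∅ᶜ : Set V) := ⟨fun v => ⟨v, by simp⟩, fun h => h⟩
    exact ⟨by simp, by simp, h.map φ⟩

theorem cutPrime_empty : cutPrime K G ∅ = binomialEdgeIdeal K (componentCompletion G ∅) := by
  simp [cutPrime]

theorem binomial_mem_cutPrime_empty {i j : V} (h : G.Reachable i j) :
    xVar K i * yVar K j - xVar K j * yVar K i ∈ cutPrime K G ∅ := by
  rw [cutPrime_empty]
  by_cases hij : i = j
  · simp [hij]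
  · exact Ideal.subset_span ⟨i, j, componentCompletion_empty_adj.2 ⟨hij, h⟩, rfl⟩

theorem cutPrime_empty_eq_ker [Finite V] :
    cutPrime K G ∅ = RingHom.ker (blockHom K G.connectedComponentMk) := by
  refine le_antisymm ?_ (ker_blockHom_le fun i j h => ?_)
  · rw [cutPrime_empty]
    refine binomialEdgeIdeal_le_ker_segreHom fun i j h => Or.inr (Or.inr ?_)
    rw [SimpleGraph.ConnectedComponent.eq.2 (componentCompletion_empty_adj.1 h).2]
  · exact binomial_mem_cutPrime_empty (SimpleGraph.ConnectedComponent.eq.1 h)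

theorem cutPrime_empty_isPrime [Finite V] : (cutPrime K G ∅).IsPrime := by
  rw [cutPrime_empty_eq_ker]
  exact RingHom.ker_isPrime _

theorem binomialEdgeIdeal_mono {H : SimpleGraph V} (h : G ≤ H) :
    binomialEdgeIdeal K G ≤ binomialEdgeIdeal K H := by
  refine Ideal.span_mono ?_
  rintro _ ⟨i, j, hij, rfl⟩
  exact ⟨i, j, h hij, rfl⟩

theorem binomialEdgeIdeal_le_cutPrime_empty : binomialEdgeIdeal K G ≤ cutPrime K G ∅ := by
  rw [cutPrime_empty]
  exact binomialEdgeIdeal_mono fun i j h => componentCompletion_empty_adj.2 ⟨h.ne, h.reachable⟩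

end EmptyCut

/-! ### Completion sets -/

section Completion

variable {V : Type*} {G : SimpleGraph V}

theorem le_foldl_completeAt (s : Multiset V) (H : SimpleGraph V) :
    H ≤ s.foldl completeAt H := by
  induction s using Multiset.induction_on generalizing H with
  | empty => simp
  | cons a s ih =>
    rw [Multiset.foldl_cons]
    exact le_trans (fun i j h => Or.inl h) (ih _)

/-- The neighbours of a vertex of `W` are pairwise adjacent in `G_W`, and completing at further
vertices preserves this. -/
theorem foldl_completeAt_adj (s : Multiset V) (H : SimpleGraph V) {v : V}
    (h : v ∈ s ∨ ∀ i j, H.Adj v i → H.Adj v j → i ≠ j → H.Adj i j) {i j : V}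
    (hi : (s.foldl completeAt H).Adj v i) (hj : (s.foldl completeAt H).Adj v j) (hij : i ≠ j) :
    (s.foldl completeAt H).Adj i j := by
  induction s using Multiset.induction_on generalizing H with
  | empty =>
    have h' : ∀ i j, H.Adj v i → H.Adj v j → i ≠ j → H.Adj i j := by simpa using h
    exact h' i j hi hj hij
  | cons a s ih =>
    rw [Multiset.foldl_cons] at *
    refine ih _ ?_ hi hj
    have h1 := H.adj_comm
    have h2 : ∀ a, ¬ H.Adj a a := fun a => H.loopless.irrefl a
    rw [Multiset.mem_cons] at h
    by_cases hs : v ∈ s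
    · exact Or.inl hs
    right
    intro i j
    simp only [completeAt]
    grind

theorem reachable_of_foldl_completeAt (s : Multiset V) (H : SimpleGraph V) {i j : V}
    (h : (s.foldl completeAt H).Reachable i j) : H.Reachable i j := by
  induction s using Multiset.induction_on generalizing H with
  | empty => simpa using h
  | cons a s ih =>
    rw [Multiset.foldl_cons] at h
    obtain ⟨p⟩ := ih _ h
    clear h ih
    induction p with
    | nil => exact .refl _
    | cons hab _ ih' =>
      refine SimpleGraph.Reachable.trans ?_ ih'
      rcases hab with h | ⟨_, h₁, h₂⟩
      · exact h.reachable
      · exact h₁.reachable.symm.trans h₂.reachable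

/-- The subgraph of `G` obtained by isolating the vertices of `T`. -/
def isolate (G : SimpleGraph V) (T : Set V) : SimpleGraph V where
  Adj i j := G.Adj i j ∧ i ∉ T ∧ j ∉ T
  symm := ⟨fun _ _ h => ⟨h.1.symm, h.2.2, h.2.1⟩⟩
  loopless := ⟨fun _ h => h.1.ne rfl⟩

/-- Vertices that are joined by a path of `G` with interior in `W` are adjacent in `G_W`. -/
theorem iteratedCompletion_adj_of_reachable {W : Finset V} {T : Set V} {i j : V}
    (hT : ∀ v, v ∉ T → v ∈ W ∨ v = i ∨ v = j) (hij : i ≠ j)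
    (h : (isolate G T).Reachable i j) : (iteratedCompletion G W).Adj i j := by
  by_contra hadj
  -- as `j` is not adjacent to `i` in `G_W`, no edge of `G \ T` leaves the closed neighbourhood
  -- of `i` in `G_W`
  have key : ∀ a b, (isolate G T).Reachable a b →
      (a = i ∨ (iteratedCompletion G W).Adj i a) → (b = i ∨ (iteratedCompletion G W).Adj i b) := by
    rintro a b ⟨p⟩
    induction p with
    | nil => exact id
    | @cons a c b hac _ ih =>
      intro ha
      refine ih ?_
      have hac' : (iteratedCompletion G W).Adj a c := le_foldl_completeAt _ _ hac.1
      rcases ha with rfl | ha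
      · exact Or.inr hac'
      rcases hT a hac.2.1 with hW | rfl | rfl
      · by_cases hci : c = i
        · exact Or.inl hci
        · exact Or.inr (foldl_completeAt_adj _ _ (Or.inl hW) ha.symm hac' (Ne.symm hci))
      · exact absurd rfl ha.ne
      · exact absurd ha hadj
  rcases key i j h (Or.inl rfl) with h | h
  · exact hij h.symm
  · exact hadj h

theorem IsCompletionSet.minComp_le {W : Finset V} (h : IsCompletionSet G W) :
    minComp G ≤ W.card := by
  obtain ⟨U, ⟨hUW, hU⟩, hmin⟩ := (wellFounded_lt (α := Finset V)).has_min
    {U | U ⊆ W ∧ IsCompletionSet G U} ⟨W, subset_rfl, h⟩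
  have hmem : IsMinimalCompletionSet G U :=
    ⟨hU, fun U' hU' hc => hmin U' ⟨hU'.subset.trans hUW, hc⟩ hU'⟩
  exact (Nat.sInf_le ⟨U, hmem, rfl⟩ : minComp G ≤ U.card).trans (Finset.card_le_card hUW)

theorem exists_isCompletionSet_card_eq_minComp [Finite V] (G : SimpleGraph V) :
    ∃ W : Finset V, IsCompletionSet G W ∧ W.card = minComp G := by
  obtain ⟨W, hW⟩ := exists_isMinimalCompletionSet G
  obtain ⟨U, hU, hc⟩ := Nat.sInf_mem
    (s := {k | ∃ W : Finset V, IsMinimalCompletionSet G W ∧ W.card = k}) ⟨_, W, hW, rfl⟩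
  exact ⟨U, hU.1, hc⟩

end Completion

/-! ### Multipliers of `P_∅(G)` into `J_G` -/

section Multiplier

variable {V K : Type*} [Field K] {G : SimpleGraph V}

theorem xVar_mul_mem {v : V} {g : MvPolynomial (V ⊕ V) K}
    (hg : g ∈ binomialEdgeIdeal K (completeAt G v)) : xVar K v * g ∈ binomialEdgeIdeal K G := by
  suffices binomialEdgeIdeal K (completeAt G v) ≤ (binomialEdgeIdeal K G).colon {xVar K v} by
    simpa [mul_comm] using Submodule.mem_colon_singleton.1 (this hg)
  refine Ideal.span_le.2 ?_
  rintro _ ⟨i, j, hij, rfl⟩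
  rw [SetLike.mem_coe, Submodule.mem_colon_singleton, smul_eq_mul]
  rcases hij with h | ⟨_, hi, hj⟩
  · exact Ideal.mul_mem_right _ _ (Ideal.subset_span ⟨i, j, h, rfl⟩)
  · have h₁ : xVar K v * yVar K i - xVar K i * yVar K v ∈ binomialEdgeIdeal K G :=
      Ideal.subset_span ⟨v, i, hi, rfl⟩
    have h₂ : xVar K v * yVar K j - xVar K j * yVar K v ∈ binomialEdgeIdeal K G :=
      Ideal.subset_span ⟨v, j, hj, rfl⟩
    convert Ideal.sub_mem _ (Ideal.mul_mem_left _ (xVar K i) h₂)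
      (Ideal.mul_mem_left _ (xVar K j) h₁) using 1
    ring

theorem prod_xVar_mul_mem (s : Multiset V) (H : SimpleGraph V) {g : MvPolynomial (V ⊕ V) K}
    (hg : g ∈ binomialEdgeIdeal K (s.foldl completeAt H)) :
    (s.map (xVar K)).prod * g ∈ binomialEdgeIdeal K H := by
  induction s using Multiset.induction_on generalizing H with
  | empty => simpa using hg
  | cons a s ih =>
    rw [Multiset.foldl_cons] at hg
    rw [Multiset.map_cons, Multiset.prod_cons, mul_assoc]
    exact xVar_mul_mem (ih _ hg)

/-- For a completion set `W` one has `J_{G_W} = P_∅(G)`, so that `∏_{v ∈ W} x_v` multiplies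
`P_∅(G)` into `J_G`. -/
theorem IsCompletionSet.prod_xVar_mul_mem {W : Finset V} (hW : IsCompletionSet G W)
    {g : MvPolynomial (V ⊕ V) K} (hg : g ∈ cutPrime K G ∅) :
    (∏ v ∈ W, xVar K v) * g ∈ binomialEdgeIdeal K G := by
  refine BinomialEdgeIdeal.prod_xVar_mul_mem W.val G ?_
  rw [cutPrime_empty] at hg
  refine binomialEdgeIdeal_mono (fun i j h => ?_) hg
  rw [componentCompletion_empty_adj] at h
  exact hW i j (h.2.mono (le_foldl_completeAt _ _)) h.1

theorem prod_xVar_notMem [Finite V] (W : Finset V) :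
    ∏ v ∈ W, xVar K v ∉ cutPrime K G ∅ := by
  rw [cutPrime_empty_eq_ker, RingHom.mem_ker, map_prod, ← ne_eq, Finset.prod_ne_zero_iff]
  intro v _
  simp [blockHom]

theorem colon_eq_cutPrime_empty [Finite V] {f : MvPolynomial (V ⊕ V) K}
    (hf : f ∉ cutPrime K G ∅) (h : ∀ g ∈ cutPrime K G ∅, f * g ∈ binomialEdgeIdeal K G) :
    (binomialEdgeIdeal K G).colon {f} = cutPrime K G ∅ := by
  ext g
  rw [Submodule.mem_colon_singleton, smul_eq_mul]
  refine ⟨fun hg => ?_, fun hg => mul_comm f g ▸ h g hg⟩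
  exact (cutPrime_empty_isPrime.mem_or_mem
    (binomialEdgeIdeal_le_cutPrime_empty hg)).resolve_right hf

/-- `J_G` and `P_∅(G)` agree locally at `P_∅(G)`, so a polynomial `f ∈ P_∅(G)` is killed modulo
`J_G` by a polynomial outside `P_∅(G)`. -/
theorem notMem_of_colon_eq [Finite V] {f : MvPolynomial (V ⊕ V) K}
    (h : (binomialEdgeIdeal K G).colon {f} = cutPrime K G ∅) : f ∉ cutPrime K G ∅ := by
  intro hf
  obtain ⟨W, hW, -⟩ := exists_isCompletionSet_card_eq_minComp G
  refine prod_xVar_notMem (K := K) (G := G) W ?_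
  rw [← h, Submodule.mem_colon_singleton, smul_eq_mul]
  exact hW.prod_xVar_mul_mem hf

/-- Setting to zero some variables leaves the coefficients of the monomials without these
variables unchanged. -/
theorem coeff_aeval_ite {σ : Type*} (T : Set σ) [DecidablePred (· ∈ T)] (p : MvPolynomial σ K)
    {α : σ →₀ ℕ} (hα : ∀ s ∈ T, α s = 0) :
    coeff α (aeval (fun s => if s ∈ T then (0 : MvPolynomial σ K) else X s) p) = coeff α p := by
  let I : Ideal (MvPolynomial σ K) := Ideal.span (X '' T)
  have hcomp : (Ideal.Quotient.mkₐ K I).comp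
      (aeval fun s => if s ∈ T then (0 : MvPolynomial σ K) else X s) =
        Ideal.Quotient.mkₐ K I := by
    refine algHom_ext fun s => ?_
    by_cases hs : s ∈ T
    · have : Ideal.Quotient.mk I (X s) = 0 :=
        Ideal.Quotient.eq_zero_iff_mem.2 (Ideal.subset_span ⟨s, hs, rfl⟩)
      simp [hs, this]
    · simp [hs]
  have hmem := Ideal.Quotient.eq.1 (DFunLike.congr_fun hcomp p)
  rw [mem_ideal_span_X_image] at hmem
  by_contra hne
  obtain ⟨s, hs, hne'⟩ := hmem α (by rwa [mem_support_iff, coeff_sub, sub_ne_zero])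
  exact hne' (hα s hs)

/-- The parametrization of `P_T(G)`, specialized from the components of `G \ T` to those of `G`,
is the parametrization of `P_∅(G)` with the variables of `T` set to zero. Hence the image
of a multiplier `f` of `P_∅(G)` into `J_G` becomes zero at `a_T = 0` as soon as `T`
separates two vertices that are connected in `G`. -/
theorem coeff_blockHom_eq_zero {f : MvPolynomial (V ⊕ V) K}
    (h : ∀ g ∈ cutPrime K G ∅, f * g ∈ binomialEdgeIdeal K G) {T : Set V} {i j : V}
    (hi : i ∉ T) (hj : j ∉ T) (hG : G.Reachable i j) (hT : ¬ (isolate G T).Reachable i j)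
    {α : V ⊕ G.ConnectedComponent →₀ ℕ} (hα : ∀ v ∈ T, α (Sum.inl v) = 0) :
    coeff α (blockHom K G.connectedComponentMk f) = 0 := by
  classical
  let a : V → MvPolynomial (V ⊕ (isolate G T).ConnectedComponent) K :=
    fun v => if v ∈ T then 0 else X (Sum.inl v)
  let b : V → MvPolynomial (V ⊕ (isolate G T).ConnectedComponent) K :=
    fun v => X (Sum.inr ((isolate G T).connectedComponentMk v))
  have hJ : binomialEdgeIdeal K G ≤ RingHom.ker (segreHom (K := K) a b) := by
    refine binomialEdgeIdeal_le_ker_segreHom fun k l hkl => ?_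
    by_cases hk : k ∈ T
    · simp [a, hk]
    by_cases hl : l ∈ T
    · simp [a, hl]
    have : (isolate G T).Adj k l := ⟨hkl, hk, hl⟩
    simp only [b, SimpleGraph.ConnectedComponent.eq.2 this.reachable, or_true]
  have hf : segreHom a b f = 0 := by
    have h0 := hJ (h _ (binomial_mem_cutPrime_empty hG))
    rw [RingHom.mem_ker, map_mul, segreHom_binomial] at h0
    refine (mul_eq_zero.1 h0).resolve_right ?_
    refine mul_ne_zero (by simp [a, hi, hj]) (sub_ne_zero.2 fun e => hT ?_)
    exact (SimpleGraph.ConnectedComponent.eq.1 (Sum.inr_injective (X_injective e))).symm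
  let q : (isolate G T).ConnectedComponent → G.ConnectedComponent :=
    SimpleGraph.ConnectedComponent.map (SimpleGraph.Hom.ofLE fun _ _ h => h.1)
  have hcomp : (rename (Sum.map id q)).comp (segreHom (K := K) a b) =
      (aeval fun s => if s ∈ Sum.inl '' T then (0 : MvPolynomial (V ⊕ G.ConnectedComponent) K)
        else X s).comp (blockHom K G.connectedComponentMk) := by
    rw [blockHom, comp_segreHom, comp_segreHom]
    congr 1
    · funext v
      by_cases hv : v ∈ T <;> simp [a, hv]
    · funext v
      simp [b, q]
  rw [← coeff_aeval_ite (Sum.inl '' T) _ (by rintro _ ⟨v, hv, rfl⟩; exact hα v hv)]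
  have := DFunLike.congr_fun hcomp f
  simp only [AlgHom.comp_apply, hf, map_zero] at this
  rw [← this, coeff_zero]

/-- The vertices that occur in a monomial of the image of a multiplier `f` under the
parametrization of `P_∅(G)` form a completion set, and there are at most `deg f` of them. -/
theorem minComp_le_of_isHomogeneous [Finite V] {f : MvPolynomial (V ⊕ V) K} {d : ℕ}
    (hd : f.IsHomogeneous d) (hf : f ∉ cutPrime K G ∅)
    (h : ∀ g ∈ cutPrime K G ∅, f * g ∈ binomialEdgeIdeal K G) : minComp G ≤ d := by
  classical
  have := Fintype.ofFinite V
  rw [cutPrime_empty_eq_ker, RingHom.mem_ker] at hf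
  obtain ⟨α, hα⟩ := ne_zero_iff.1 hf
  -- a monomial of the image comes from a monomial of `f`, which gives the degree of its `a`-part
  obtain ⟨m, hm, rfl⟩ : ∃ m, coeff m f ≠ 0 ∧
      Finsupp.weight (blockExponent G.connectedComponentMk) m = α := by
    by_contra! hcon
    refine hα ?_
    conv_lhs => rw [f.as_sum, map_sum, coeff_sum]
    refine Finset.sum_eq_zero fun m hm => ?_
    rw [blockHom_monomial, coeff_monomial, if_neg (hcon m (mem_support_iff.1 hm))]
  let W : Finset V := {i | m (Sum.inl i) + m (Sum.inr i) ≠ 0}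
  have hcard : W.card ≤ d := by
    have hdeg : m.degree = d := by
      rw [Finsupp.degree_eq_weight_one]
      exact hd hm
    rw [← hdeg, Finsupp.degree_eq_sum, Fintype.sum_sum_type, ← Finset.sum_add_distrib,
      Finset.card_eq_sum_ones]
    refine (Finset.sum_le_sum fun i hi => ?_).trans
      (Finset.sum_le_sum_of_subset (Finset.subset_univ W))
    exact Nat.one_le_iff_ne_zero.2 (by simpa [W] using hi)
  refine le_trans (IsCompletionSet.minComp_le (W := W) fun i j hij hne => ?_) hcard
  let T : Set V := {v | v ∉ W ∧ v ≠ i ∧ v ≠ j}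
  refine iteratedCompletion_adj_of_reachable (T := T) (fun v hv => ?_) hne ?_
  · by_contra! hcon
    exact hv hcon
  · by_contra hT
    refine hα (coeff_blockHom_eq_zero h (fun hi => hi.2.1 rfl) (fun hj => hj.2.2 rfl)
      (reachable_of_foldl_completeAt _ _ hij) hT fun v hv => ?_)
    rw [weight_blockExponent_inl]
    by_contra hv'
    exact hv.1 (by simpa [W] using hv')

end Multiplier

end BinomialEdgeIdeal

open BinomialEdgeIdeal in
theorem theorem3p6 {V : Type*} [Finite V] (K : Type*) [Field K] (G : SimpleGraph V) :
    BinomialEdgeIdeal.cutPrime K G ∅ ∈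
        (BinomialEdgeIdeal.binomialEdgeIdeal K G).minimalPrimes ∧
      BinomialEdgeIdeal.cutPrime K G ∅ ∈
        associatedPrimes (MvPolynomial (V ⊕ V) K)
          (MvPolynomial (V ⊕ V) K ⧸ BinomialEdgeIdeal.binomialEdgeIdeal K G) ∧
      BinomialEdgeIdeal.localVNumber (BinomialEdgeIdeal.binomialEdgeIdeal K G)
          (BinomialEdgeIdeal.cutPrime K G ∅) = BinomialEdgeIdeal.minComp G ∧
      BinomialEdgeIdeal.vNumber (BinomialEdgeIdeal.binomialEdgeIdeal K G) ≤
        BinomialEdgeIdeal.minComp G := by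
  have hprime : (cutPrime K G ∅).IsPrime := cutPrime_empty_isPrime
  obtain ⟨W, hW, hcard⟩ := exists_isCompletionSet_card_eq_minComp G
  have hcolon := colon_eq_cutPrime_empty (prod_xVar_notMem (K := K) (G := G) W)
    fun g hg => hW.prod_xVar_mul_mem hg
  have hhom : (∏ v ∈ W, xVar K v).IsHomogeneous (minComp G) := by
    rw [← hcard, Finset.card_eq_sum_ones]
    exact MvPolynomial.IsHomogeneous.prod _ _ _ fun v _ => MvPolynomial.isHomogeneous_X _ _
  have hass : cutPrime K G ∅ ∈ associatedPrimes (MvPolynomial (V ⊕ V) K)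
      (MvPolynomial (V ⊕ V) K ⧸ binomialEdgeIdeal K G) := by
    refine ⟨hprime, Ideal.Quotient.mk _ (∏ v ∈ W, xVar K v), ?_⟩
    have hbot : Submodule.colon (⊥ : Submodule (MvPolynomial (V ⊕ V) K)
        (MvPolynomial (V ⊕ V) K ⧸ binomialEdgeIdeal K G))
        {Ideal.Quotient.mk _ (∏ v ∈ W, xVar K v)} = cutPrime K G ∅ := by
      rw [← hcolon]
      ext g
      rw [Submodule.mem_colon_singleton, Submodule.mem_colon_singleton, Submodule.mem_bot,
        smul_eq_mul, ← Ideal.Quotient.eq_zero_iff_mem, map_mul]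
      rfl
    rw [hbot, hprime.radical]
  refine ⟨⟨⟨hprime, binomialEdgeIdeal_le_cutPrime_empty⟩, ?_⟩, hass, le_antisymm ?_ ?_, ?_⟩
  · rintro q ⟨hq, hJq⟩ hqP g hg
    exact (hq.mem_or_mem (hJq (hW.prod_xVar_mul_mem hg))).resolve_left
      fun hmem => prod_xVar_notMem W (hqP hmem)
  · exact iInf₂_le (minComp G) ⟨_, hhom, hcolon⟩
  · refine le_iInf₂ ?_
    rintro d ⟨f, hd, hf⟩
    refine Nat.cast_le.2 (minComp_le_of_isHomogeneous hd (notMem_of_colon_eq hf) fun g hg => ?_)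
    rw [← hf, Submodule.mem_colon_singleton, smul_eq_mul, mul_comm] at hg
    exact hg
  · exact iInf₂_le (minComp G) ⟨_, hhom, _, hass, hcolon⟩
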